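/- For real $r$ and integers $n\ge k\ge 0$, let $$\genfrac[]{0pt}{}{n}{k}_r=\sum_{j=k}^n \genfrac[]{0pt}{}{n}{j}\binom{j}{k} r^{j-k},\qquad \genfrac\{\}{0pt}{}{n}{k}_r=\sum_{j=k}^n \binom{n}{j}\genfrac\{\}{0pt}{}{j}{k} r^{n-j}$$ (with $0^0=1$) be the $r$-Stirling numbers of the first and second kind, where $\genfrac[]{0pt}{}{n}{j}$ and $\genfrac\{\}{0pt}{}{j}{k}$ are the ordinary Stirling numbers of the first and second kind, and let $L(n,k)_r=\sum_{j=k}^n \genfrac[]{0pt}{}{n}{j}_r\genfrac\{\}{0pt}{}{j}{k}_r$. For $r\ge 0$ with $\max\{k,r\}>0$ and $n\ge\max\{k,1\}$, a random variable $\mathrm{Lah}(n,k)_r$ has the $r$-Lah distribution if $$\mathbb P[\mathrm{Lah}(n,k)_r=j]=\frac{1}{L(n,k)_r}\genfrac[]{0pt}{}{n}{j}_r\genfrac\{\}{0pt}{}{j}{k}_r,\qquad j\in\{k,k+1,\dots,n\}.$$ **Theorem (Precise asymptotics of large deviations).** Let $k\in\mathbb N_0$ and $r\in[0,\infty)$ be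 fixed with $\max\{k,r\}>0$, and let $(x_n)_{n\in\mathbb N}$ be a sequence of real numbers converging to some $x>0$ such that $(k+r)x_n\log n$ is an integer for all $n\in\mathbb N=\{1,2,\dots\}$. Then, as $n\to\infty$, $$\mathbb P\bigl[\mathrm{Lah}(n,k)_r=(k+r)x_n\log n\bigr]\sim \frac{n^{-(k+r)(x_n\log x_n-x_n+1)}}{\sqrt{2\pi(k+r)x\log n}}\,\frac{\Gamma(k+2r)}{\Gamma((k+r)x+r)};$$ if moreover $x>1$, then $$\mathbb P\bigl[\mathrm{Lah}(n,k)_r\ge(k+r)x_n\log n\bigr]\sim \frac{x}{x-1}\,\frac{n^{-(k+r)(x_n\log x_n-x_n+1)}}{\sqrt{2\pi(k+r)x\log n}}\,\frac{\Gamma(k+2r)}{\Gamma((k+r)x+r)};$$ and if $x<1$, then $$\mathbb P\bigl[\mathrm{Lah}(n,k)_r\le(k+r)x_n\log n\bigr]\sim \frac{1}{1-x}\,\frac{n^{-(k+r)(x_n\log x_n-x_n+1)}}{\sqrt{2\pi(k+r)x\log n}}\,\frac{\Gamma(k+2r)}{\Gamma((k+r)x+r)}.$$ Here $a_n\sim b_n$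 means $a_n/b_n\to1$ as $n\to\infty$. -/

import Mathlib

open Filter Topology MeasureTheory

/-- The `r`-Stirling number of the first kind, for real `r`:
`∑_{j=k}^n [n, j] (j choose k) r^(j-k)`, where `[n, j]` is the Stirling number of the first kind.
It is `0` for `n < k`. -/
noncomputable def rStirlingFirst (r : ℝ) (n k : ℕ) : ℝ :=
  ∑ j ∈ Finset.Icc k n, (Nat.stirlingFirst n j : ℝ) * (j.choose k : ℝ) * r ^ (j - k)

/-- The `r`-Stirling number of the second kind, for real `r`:
`∑_{j=k}^n (n choose j) {j, k} r^(n-j)`, where `{j, k}` is the Stirling number of the second kind.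
It is `0` for `n < k`. -/
noncomputable def rStirlingSecond (r : ℝ) (n k : ℕ) : ℝ :=
  ∑ j ∈ Finset.Icc k n, (n.choose j : ℝ) * (Nat.stirlingSecond j k : ℝ) * r ^ (n - j)

/-- The `r`-Lah number `L(n,k)_r`. -/
noncomputable def rLahNumber (r : ℝ) (n k : ℕ) : ℝ :=
  ∑ j ∈ Finset.Icc k n, rStirlingFirst r n j * rStirlingSecond r j k

/-- The `r`-Lah distribution `Lah(n,k)_r`, as a measure on `ℕ`: it gives the mass
`[n, j]_r {j, k}_r / L(n,k)_r` to each `j ∈ {k, …, n}`. -/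
noncomputable def rLahDistribution (r : ℝ) (n k : ℕ) : Measure ℕ :=
  ∑ j ∈ Finset.Icc k n,
    ENNReal.ofReal (rStirlingFirst r n j * rStirlingSecond r j k / rLahNumber r n k) •
      Measure.dirac j

theorem rStirlingFirst_nonneg {r : ℝ} (hr : 0 ≤ r) (n k : ℕ) : 0 ≤ rStirlingFirst r n k :=
  Finset.sum_nonneg fun _ _ => by positivity

theorem rStirlingSecond_nonneg {r : ℝ} (hr : 0 ≤ r) (n k : ℕ) : 0 ≤ rStirlingSecond r n k :=
  Finset.sum_nonneg fun _ _ => by positivity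

theorem stirlingSecond_pos_aux (n k : ℕ) (h : k ≤ n) : 0 < Nat.stirlingSecond (n + 1) (k + 1) := by
  induction n generalizing k with
  | zero =>
    obtain rfl : k = 0 := by omega
    decide
  | succ n ih =>
    rw [Nat.stirlingSecond_succ_succ]
    cases k with
    | zero =>
      have := ih 0 (Nat.zero_le _)
      simp only [zero_add] at this ⊢
      omega
    | succ k =>
      have := ih k (by omega)
      omega

theorem rLahNumber_pos {r : ℝ} {n k : ℕ} (hr : 0 ≤ r) (hkr : 0 < max (k : ℝ) r) (hkn : k ≤ n) :
    0 < rLahNumber r n k := by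
  refine Finset.sum_pos' (fun j _ => mul_nonneg (rStirlingFirst_nonneg hr n j)
    (rStirlingSecond_nonneg hr j k)) ⟨n, by simp [hkn], mul_pos ?_ ?_⟩
  · simp [rStirlingFirst, Nat.stirlingFirst_self]
  · rcases Nat.eq_zero_or_pos k with rfl | hk
    · have hr' : 0 < r := by simpa using hkr
      refine Finset.sum_pos' (fun _ _ => by positivity) ⟨0, by simp, ?_⟩
      simp [hr']
    · refine Finset.sum_pos' (fun _ _ => by positivity) ⟨n, by simp [hkn], ?_⟩
      obtain ⟨k, rfl⟩ : ∃ m, k = m + 1 := ⟨k - 1, by omega⟩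
      obtain ⟨n, rfl⟩ : ∃ m, n = m + 1 := ⟨n - 1, by omega⟩
      have := stirlingSecond_pos_aux n k (by omega)
      simp [this]

/-- For admissible parameters the `r`-Lah distribution is a probability measure. -/
theorem isProbabilityMeasure_rLahDistribution {r : ℝ} {n k : ℕ} (hr : 0 ≤ r)
    (hkr : 0 < max (k : ℝ) r) (hkn : k ≤ n) : IsProbabilityMeasure (rLahDistribution r n k) := by
  have hL := rLahNumber_pos hr hkr hkn
  constructor
  simp only [rLahDistribution, Measure.coe_finsetSum, Finset.sum_apply, Measure.smul_apply,
    measure_univ, smul_eq_mul, mul_one]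
  rw [← ENNReal.ofReal_sum_of_nonneg, ← Finset.sum_div]
  · change ENNReal.ofReal (rLahNumber r n k / rLahNumber r n k) = 1
    rw [div_self hL.ne', ENNReal.ofReal_one]
  · exact fun j _ => div_nonneg (mul_nonneg (rStirlingFirst_nonneg hr n j)
      (rStirlingSecond_nonneg hr j k)) hL.le

/-! At `j ~ c log n` the mass at `j` is asymptotically a Poisson weight of parameter `(k + r) log n`
times `Γ(k + 2r) / Γ(c + r)`; Stirling's formula for that weight gives the power of `n` and the
square root, and `c = (k + r) x` gives the Gamma factor.

The delicate ingredient is the first-kind number. Its generating polynomial is `∏ (y + r + i) = (n!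
/ n) n^r e^(y log n) G_n(y)`, where `G_n(y) → 1 / Γ(y + r)` and the `G_n` are bounded uniformly on
discs. Taking `j` derivatives at `0` by Leibniz and dividing by `(log n)^j` leaves a sum whose
`m`-th term tends to the `m`-th Taylor term of `1 / Γ(y + r)` at `y = c`; Cauchy estimates dominate
it (`tendsto_sum_choose_mul_iteratedDeriv`, `tendsto_rStirlingFirst`). No saddle point analysis is
needed. The second-kind and Lah numbers are alternating sums in which only the top term matters.

For the tails, divide by the mass at the boundary point. Mass ratios at fixed distance `m` tend to
`x^(-m)` above and `x^m` below, so the tail factor is a geometric series. Log-concavity of the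
first-kind numbers (`rStirlingFirst_mul_le`) turns one ratio bound next to the boundary into the
geometric bound that lets limit and sum be exchanged. -/

/-! ### Euler's limit for the reciprocal Gamma function, with bounds uniform on discs -/

/-- The normalised rising factorial `s (s + 1) ⋯ (s + n - 1) n^(1 - s) / n!`, which converges
to `1 / Γ(s)`. -/
noncomputable def normalizedRising (s : ℂ) (n : ℕ) : ℂ :=
  (∏ i ∈ Finset.range n, (s + i)) * ((n : ℂ) / n.factorial) * Complex.exp (-s * Real.log n)

theorem differentiable_normalizedRising (n : ℕ) :
    Differentiable ℂ fun s => normalizedRising s n := by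
  unfold normalizedRising
  fun_prop

theorem normalizedRising_succ (s : ℂ) {n : ℕ} (hn : 1 ≤ n) :
    normalizedRising s (n + 1) = normalizedRising s n * ((1 + s / n) *
      Complex.exp (-s * (Real.log (n + 1) - Real.log n : ℝ))) := by
  have h0 : (n : ℂ) ≠ 0 := by exact_mod_cast (by omega : n ≠ 0)
  have h1 : ((n : ℂ) + 1) ≠ 0 := by exact_mod_cast n.succ_ne_zero
  have h2 : (n.factorial : ℂ) ≠ 0 := by exact_mod_cast n.factorial_ne_zero
  have h3 : Complex.exp (-s * Real.log ((n + 1 : ℕ) : ℝ)) = Complex.exp (-s * Real.log n) *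
      Complex.exp (-s * (Real.log (n + 1) - Real.log n : ℝ)) := by
    rw [← Complex.exp_add]
    push_cast
    ring_nf
  unfold normalizedRising
  rw [h3, Finset.prod_range_succ, Nat.factorial_succ]
  push_cast
  field_simp
  ring

/-- Keeping the real part of `z` instead of its norm lets the first-order term cancel later against
the exponential factor of `normalizedRising_succ`. -/
theorem norm_one_add_le_exp (z : ℂ) : ‖1 + z‖ ≤ Real.exp (z.re + ‖z‖ ^ 2 / 2) := by
  have h : ‖1 + z‖ ^ 2 ≤ Real.exp (z.re + ‖z‖ ^ 2 / 2) ^ 2 := by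
    have h1 : ‖1 + z‖ ^ 2 = (2 * z.re + ‖z‖ ^ 2) + 1 := by
      rw [Complex.sq_norm, Complex.sq_norm, Complex.normSq_apply, Complex.normSq_apply]
      simp
      ring
    rw [h1, ← Real.exp_nat_mul]
    refine (Real.add_one_le_exp _).trans (Real.exp_le_exp.2 (le_of_eq ?_))
    push_cast
    ring
  exact le_of_sq_le_sq h (Real.exp_pos _).le

theorem abs_inv_sub_log_le {n : ℕ} (hn : 1 ≤ n) :
    |(n : ℝ)⁻¹ - (Real.log (n + 1) - Real.log n)| ≤ (n : ℝ)⁻¹ - ((n : ℝ) + 1)⁻¹ := by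
  have h0 : (0 : ℝ) < n := by exact_mod_cast hn
  have h1 : Real.log (n + 1) - Real.log n = Real.log (1 + (n : ℝ)⁻¹) := by
    rw [← Real.log_div (by positivity) h0.ne']
    congr 1
    field_simp
  have h2 : Real.log (1 + (n : ℝ)⁻¹) ≤ (n : ℝ)⁻¹ := by
    have := Real.log_le_sub_one_of_pos (show 0 < 1 + (n : ℝ)⁻¹ by positivity)
    linarith
  have h3 : ((n : ℝ) + 1)⁻¹ ≤ Real.log (1 + (n : ℝ)⁻¹) := by
    have := Real.one_sub_inv_le_log_of_pos (show 0 < 1 + (n : ℝ)⁻¹ by positivity)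
    refine le_trans (le_of_eq ?_) this
    field_simp
    ring
  rw [h1, abs_of_nonneg (by linarith)]
  linarith

/-- Passing from `n` to `n + 1` costs at most a factor `exp ((B + B ^ 2) (1/n - 1/(n+1)))`, and
these exponents telescope. The resulting bound is uniform in `n` and in `s` on the disc. -/
theorem norm_normalizedRising_le {B : ℝ} {s : ℂ} (hs : ‖s‖ ≤ B) {n : ℕ} (hn : 1 ≤ n) :
    ‖normalizedRising s n‖ ≤ B * Real.exp ((B + B ^ 2) * (1 - (n : ℝ)⁻¹)) := by
  have hB : 0 ≤ B := (norm_nonneg s).trans hs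
  induction n, hn using Nat.le_induction with
  | base => simpa [normalizedRising] using hs
  | succ n hn ih =>
    have h0 : (0 : ℝ) < n := by exact_mod_cast hn
    set d : ℝ := (n : ℝ)⁻¹ - ((n : ℝ) + 1)⁻¹ with hd
    have hd1 : d = 1 / (n * (n + 1)) := by
      rw [hd]
      field_simp
      ring
    have key : ‖(1 + s / n) * Complex.exp (-s * (Real.log (n + 1) - Real.log n : ℝ))‖ ≤
        Real.exp ((B + B ^ 2) * d) := by
      rw [norm_mul, Complex.norm_exp]
      refine (mul_le_mul_of_nonneg_right (norm_one_add_le_exp _) (Real.exp_pos _).le).trans ?_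
      rw [← Real.exp_add]
      refine Real.exp_le_exp.2 ?_
      rw [Complex.div_natCast_re, Complex.re_mul_ofReal, Complex.neg_re, norm_div,
        Complex.norm_natCast]
      -- The first-order contributions `s / n` and `s log ((n + 1) / n)` cancel up to a telescoping
      -- error.
      have h1 : s.re / n + -s.re * (Real.log (n + 1) - Real.log n) ≤ B * d := by
        have : s.re / n + -s.re * (Real.log (n + 1) - Real.log n) =
          s.re * ((n : ℝ)⁻¹ - (Real.log (n + 1) - Real.log n)) := by ring
        rw [this]
        refine (le_abs_self _).trans ?_
        rw [abs_mul]
        exact mul_le_mul ((Complex.abs_re_le_norm s).trans hs) (abs_inv_sub_log_le hn)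
          (abs_nonneg _) hB
      have h2 : (‖s‖ / n) ^ 2 / 2 ≤ B ^ 2 * d := by
        have h3 : (1 / (n : ℝ)) ^ 2 / 2 ≤ d := by
          rw [hd1, div_pow, one_pow, div_div]
          have : (1 : ℝ) ≤ n := by exact_mod_cast hn
          exact one_div_le_one_div_of_le (by positivity) (by nlinarith)
        calc (‖s‖ / n) ^ 2 / 2 = ‖s‖ ^ 2 * ((1 / (n : ℝ)) ^ 2 / 2) := by ring
          _ ≤ B ^ 2 * d := by gcongr
      linarith
    rw [normalizedRising_succ s hn, norm_mul]
    refine (mul_le_mul ih key (norm_nonneg _) (by positivity)).trans (le_of_eq ?_)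
    rw [mul_assoc, ← Real.exp_add]
    congr 2
    rw [hd]
    push_cast
    ring

theorem tendsto_normalizedRising (s : ℂ) :
    Tendsto (normalizedRising s) atTop (𝓝 (Complex.Gamma s)⁻¹) := by
  -- At a pole of Gamma the product is eventually zero, and so is the inverse of the default value
  -- of Gamma there.
  by_cases hs : ∃ m : ℕ, s = -m
  · obtain ⟨m, rfl⟩ := hs
    rw [Complex.Gamma_neg_nat_eq_zero, inv_zero]
    refine tendsto_const_nhds.congr' ?_
    filter_upwards [eventually_gt_atTop m] with n hn
    rw [normalizedRising, Finset.prod_eq_zero (Finset.mem_range.2 hn) (by simp)]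
    simp
  · push Not at hs
    have h1 := (Complex.GammaSeq_tendsto_Gamma s).inv₀ (Complex.Gamma_ne_zero hs)
    -- `Complex.GammaSeq` has one more factor, `s + n`, in its denominator; this is the correction.
    have h2 : Tendsto (fun n : ℕ => (1 + s * (n : ℂ)⁻¹)⁻¹) atTop (𝓝 1) := by
      have h3 : Tendsto (fun n : ℕ => 1 + s * (n : ℂ)⁻¹) atTop (𝓝 (1 + s * 0)) :=
        (tendsto_inv_atTop_nhds_zero_nat (𝕜 := ℂ)).const_mul s |>.const_add 1
      simpa using h3.inv₀ (by simp)
    have h3 := h1.mul h2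
    rw [mul_one] at h3
    refine h3.congr' ?_
    filter_upwards [eventually_ge_atTop 1] with n hn
    have h0 : (n : ℂ) ≠ 0 := by exact_mod_cast (by omega : n ≠ 0)
    have h4 : s + n ≠ 0 := fun h => hs n (eq_neg_of_add_eq_zero_left h)
    have h5 : (n.factorial : ℂ) ≠ 0 := by exact_mod_cast n.factorial_ne_zero
    have h6 : (n : ℂ) ^ s ≠ 0 := by simp [Complex.cpow_eq_zero_iff, h0]
    have h7 : Complex.exp (-s * Real.log n) = ((n : ℂ) ^ s)⁻¹ := by
      rw [Complex.cpow_def_of_ne_zero h0, ← Complex.exp_neg, Complex.natCast_log]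
      ring_nf
    have h8 : (1 + s * (n : ℂ)⁻¹)⁻¹ = n / (s + n) := by
      have : 1 + s * (n : ℂ)⁻¹ = (s + n) / n := by field_simp; ring
      rw [this, inv_div]
    rw [h8, normalizedRising, h7, Complex.GammaSeq, Finset.prod_range_succ]
    field_simp

/-! ### Convergence of derivatives and of Leibniz sums -/

/-- Cauchy's formula writes the derivative as an integral over the unit circle, where pointwise
convergence and the uniform bound allow dominated convergence. -/
theorem tendsto_iteratedDeriv_of_bounded {G : ℕ → ℂ → ℂ} {g : ℂ → ℂ}
    (hG : ∀ n, Differentiable ℂ (G n)) (hg : Differentiable ℂ g) {M : ℝ}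
    (hM : ∀ᶠ n in atTop, ∀ z : ℂ, ‖z‖ ≤ 1 → ‖G n z‖ ≤ M)
    (hlim : ∀ z, Tendsto (fun n => G n z) atTop (𝓝 (g z))) (m : ℕ) :
    Tendsto (fun n => iteratedDeriv m (G n) 0) atTop (𝓝 (iteratedDeriv m g 0)) := by
  have hc : (2 * Real.pi * Complex.I / m.factorial : ℂ) ≠ 0 :=
    div_ne_zero Complex.two_pi_I_ne_zero (by exact_mod_cast m.factorial_ne_zero)
  have key : ∀ {f : ℂ → ℂ}, Differentiable ℂ f → iteratedDeriv m f 0 =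
      (2 * Real.pi * Complex.I / m.factorial : ℂ)⁻¹ *
        ∮ z in C(0, 1), (1 / (z - 0) ^ (m + 1)) • f z := fun {f} hf => by
    rw [hf.differentiableOn.circleIntegral_one_div_sub_center_pow_smul one_pos, smul_eq_mul,
      inv_mul_cancel_left₀ hc]
  simp_rw [key hg, key (hG _)]
  refine Tendsto.const_mul _ ?_
  unfold circleIntegral
  have hne : ∀ θ : ℝ, circleMap 0 1 θ ≠ 0 := fun θ => circleMap_ne_center one_ne_zero
  refine intervalIntegral.tendsto_integral_filter_of_dominated_convergence (fun _ => M)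
    (Eventually.of_forall fun n => ?_) ?_ (by simp) ?_
  · refine Continuous.aestronglyMeasurable ?_
    have h1 : Continuous fun θ : ℝ => G n (circleMap 0 1 θ) :=
      (hG n).continuous.comp (continuous_circleMap 0 1)
    have h2 : Continuous fun θ : ℝ => 1 / (circleMap 0 1 θ - 0) ^ (m + 1) := by
      refine continuous_const.div (((continuous_circleMap 0 1).sub continuous_const).pow _)
        fun θ => ?_
      simp
    have h3 : Continuous fun θ : ℝ => deriv (circleMap 0 1) θ := by
      simp only [deriv_circleMap]
      exact (continuous_circleMap 0 1).mul continuous_const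
    exact h3.smul (h2.smul h1)
  · filter_upwards [hM] with n hn
    refine Eventually.of_forall fun θ _ => ?_
    have := hn (circleMap 0 1 θ) (by simp)
    simpa [norm_smul] using this
  · refine Eventually.of_forall fun θ _ => ?_
    exact ((hlim _).const_smul _).const_smul _

theorem tendsto_descFactorial_div_pow {j : ℕ → ℕ} {ℓ : ℕ → ℝ} {c : ℝ} (hj : Tendsto j atTop atTop)
    (hℓ : Tendsto ℓ atTop atTop) (hc : Tendsto (fun n => (j n : ℝ) / ℓ n) atTop (𝓝 c)) (m : ℕ) :
    Tendsto (fun n => ((j n).descFactorial m : ℝ) / ℓ n ^ m) atTop (𝓝 (c ^ m)) := by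
  induction m with
  | zero => simp
  | succ m ih =>
    have h1 : Tendsto (fun n => (j n : ℝ) / ℓ n - m / ℓ n) atTop (𝓝 (c - 0)) :=
      hc.sub (tendsto_const_nhds.div_atTop hℓ)
    rw [sub_zero] at h1
    have h2 := h1.mul ih
    rw [pow_succ']
    refine h2.congr' ?_
    filter_upwards [hj.eventually_ge_atTop m] with n hn
    rw [Nat.descFactorial_succ, Nat.cast_mul, Nat.cast_sub hn, pow_succ', ← sub_div,
      div_mul_div_comm]

/-- Leibniz-type sums of derivatives at the origin converge to the value of the limit function. -/
theorem tendsto_sum_choose_mul_iteratedDeriv {G : ℕ → ℂ → ℂ} {g : ℂ → ℂ}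
    (hG : ∀ n, Differentiable ℂ (G n)) (hg : Differentiable ℂ g)
    (hM : ∀ B : ℝ, ∃ M : ℝ, ∀ᶠ n in atTop, ∀ z : ℂ, ‖z‖ ≤ B → ‖G n z‖ ≤ M)
    (hlim : ∀ z, Tendsto (fun n => G n z) atTop (𝓝 (g z)))
    {j : ℕ → ℕ} {ℓ : ℕ → ℝ} {c : ℝ} (hc0 : 0 < c)
    (hℓ : Tendsto ℓ atTop atTop) (hc : Tendsto (fun n => (j n : ℝ) / ℓ n) atTop (𝓝 c)) :
    Tendsto (fun n => ∑ m ∈ Finset.range (j n + 1),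
      ((j n).choose m : ℂ) * iteratedDeriv m (G n) 0 / (ℓ n : ℂ) ^ m) atTop (𝓝 (g c)) := by
  have hj : Tendsto j atTop atTop := by
    have h1 := hc.pos_mul_atTop hc0 hℓ
    refine tendsto_natCast_atTop_iff (R := ℝ) |>.1 (h1.congr' ?_)
    filter_upwards [hℓ.eventually_gt_atTop 0] with n hn
    field_simp
  have hterm : ∀ n m, ((j n).choose m : ℂ) * iteratedDeriv m (G n) 0 / (ℓ n : ℂ) ^ m =
      ((((j n).descFactorial m : ℝ) / ℓ n ^ m : ℝ) : ℂ) *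
        ((m.factorial : ℂ)⁻¹ * iteratedDeriv m (G n) 0) := by
    intro n m
    have h5 : (m.factorial : ℂ) ≠ 0 := by exact_mod_cast m.factorial_ne_zero
    rw [Nat.descFactorial_eq_factorial_mul_choose]
    push_cast
    field_simp
  have hsum : ∀ n, ∑ m ∈ Finset.range (j n + 1),
      ((j n).choose m : ℂ) * iteratedDeriv m (G n) 0 / (ℓ n : ℂ) ^ m =
      ∑' m, ((((j n).descFactorial m : ℝ) / ℓ n ^ m : ℝ) : ℂ) *
        ((m.factorial : ℂ)⁻¹ * iteratedDeriv m (G n) 0) := by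
    intro n
    rw [tsum_eq_sum (s := Finset.range (j n + 1))]
    · exact Finset.sum_congr rfl fun m _ => hterm n m
    · intro m hm
      rw [← hterm, Nat.choose_eq_zero_of_lt (by simpa using hm)]
      simp
  have hgc : g c = ∑' m : ℕ, ((c ^ m : ℝ) : ℂ) * ((m.factorial : ℂ)⁻¹ * iteratedDeriv m g 0) := by
    rw [← Complex.taylorSeries_eq_of_entire' 0 (c : ℂ) hg]
    refine tsum_congr fun m => ?_
    push_cast
    rw [sub_zero]
    ring
  simp_rw [hsum]
  rw [hgc]
  -- Eventually `j / ℓ ≤ c + 1`, while Cauchy's estimate on radius `c + 2` gives decay `(c +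
  -- 2)^(-m)`; the gap makes the dominating series geometric.
  obtain ⟨M, hMc⟩ := hM (c + 2)
  obtain ⟨M₁, hM₁⟩ := hM 1
  refine tendsto_tsum_of_dominated_convergence
    (bound := fun m => M * ((c + 1) / (c + 2)) ^ m) ?_ ?_ ?_
  · refine (summable_geometric_of_lt_one (by positivity) ?_).mul_left M
    rw [div_lt_one (by positivity)]
    linarith
  · intro m
    refine Tendsto.mul ?_ ((tendsto_iteratedDeriv_of_bounded hG hg hM₁ hlim m).const_mul _)
    exact (Complex.continuous_ofReal.tendsto _).comp (tendsto_descFactorial_div_pow hj hℓ hc m)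
  · filter_upwards [hMc, hℓ.eventually_gt_atTop 0, hc.eventually_le_const (lt_add_one c)]
      with n h1 h2 h3 m
    have h4 := Complex.norm_iteratedDeriv_le_of_forall_mem_sphere_norm_le (c := 0) (R := c + 2) m
      (by positivity) (hG n).diffContOnCl (fun z hz => h1 z (by simpa using hz.le))
    have h5 : (0 : ℝ) < m.factorial := by exact_mod_cast m.factorial_pos
    rw [norm_mul, norm_mul, norm_inv, Complex.norm_natCast, Complex.norm_real,
      Real.norm_of_nonneg (by positivity), div_pow, ← mul_div_assoc, mul_comm M,
      mul_div_assoc]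
    refine mul_le_mul ?_ ?_ (by positivity) (by positivity)
    · calc ((j n).descFactorial m : ℝ) / ℓ n ^ m ≤ (j n : ℝ) ^ m / ℓ n ^ m := by
            gcongr
            exact_mod_cast Nat.descFactorial_le_pow _ _
        _ = ((j n : ℝ) / ℓ n) ^ m := by rw [div_pow]
        _ ≤ (c + 1) ^ m := by gcongr
    · rw [inv_mul_le_iff₀ h5, ← mul_div_assoc]
      exact h4

/-! ### First kind: generating polynomial, log-concavity, local limit theorem -/

/-- The generating polynomial `(X + r) (X + r + 1) ⋯ (X + r + n - 1)` of the `r`-Stirling numbers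
of the first kind. -/
noncomputable def risingPolynomial (r : ℝ) (n : ℕ) : Polynomial ℝ :=
  ∏ i ∈ Finset.range n, (Polynomial.X + Polynomial.C (r + i))

theorem prod_X_add_natCast_eq_sum_stirlingFirst (n : ℕ) :
    ∏ i ∈ Finset.range n, (Polynomial.X + Polynomial.C (i : ℝ)) =
      ∑ i ∈ Finset.range (n + 1), Polynomial.C (Nat.stirlingFirst n i : ℝ) * Polynomial.X ^ i := by
  induction n with
  | zero => simp
  | succ n ih =>
    rw [Finset.prod_range_succ, ih, Finset.sum_range_succ' _ (n + 1), Nat.stirlingFirst_succ_zero]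
    simp only [Nat.stirlingFirst_succ_succ, Nat.cast_add, Nat.cast_mul, map_add, map_mul, add_mul,
      Finset.sum_add_distrib]
    have h : ∑ i ∈ Finset.range (n + 1), Polynomial.C (n : ℝ) *
        Polynomial.C (Nat.stirlingFirst n (i + 1) : ℝ) * Polynomial.X ^ (i + 1) =
        Polynomial.C (n : ℝ) * ∑ i ∈ Finset.range (n + 1),
          Polynomial.C (Nat.stirlingFirst n i : ℝ) * Polynomial.X ^ i := by
      rw [Finset.sum_range_succ, Nat.stirlingFirst_eq_zero_of_lt (Nat.lt_succ_self n),
        Finset.sum_range_succ' _ n, mul_add, Finset.mul_sum]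
      rcases n with _ | n
      · simp
      · simp [mul_assoc]
    rw [h, mul_add, Finset.sum_mul, Finset.sum_mul, Finset.mul_sum]
    simp only [pow_succ]
    simp [mul_comm, mul_left_comm, add_comm]

theorem coeff_risingPolynomial (r : ℝ) (n k : ℕ) :
    (risingPolynomial r n).coeff k = rStirlingFirst r n k := by
  have h : risingPolynomial r n = (∏ i ∈ Finset.range n,
      (Polynomial.X + Polynomial.C (i : ℝ))).comp (Polynomial.X + Polynomial.C r) := by
    rw [Polynomial.prod_comp, risingPolynomial]
    refine Finset.prod_congr rfl fun i _ => ?_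
    simp [add_assoc]
  rw [h, prod_X_add_natCast_eq_sum_stirlingFirst, Polynomial.sum_comp,
    Polynomial.finsetSum_coeff, rStirlingFirst]
  symm
  refine Finset.sum_subset_zero_on_sdiff (fun i hi => ?_) (fun i hi => ?_) (fun i hi => ?_)
  · simp only [Finset.mem_Icc, Finset.mem_range] at hi ⊢
    omega
  · simp only [Finset.mem_Icc, Finset.mem_range, Finset.mem_sdiff] at hi
    simp [Polynomial.coeff_X_add_C_pow, Nat.choose_eq_zero_of_lt (show i < k by omega)]
  · simp [Polynomial.coeff_X_add_C_pow]
    ring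

theorem rStirlingFirst_eq_zero_of_lt (r : ℝ) {n k : ℕ} (h : n < k) : rStirlingFirst r n k = 0 := by
  simp [rStirlingFirst, Finset.Icc_eq_empty (not_le.2 h)]

theorem rStirlingFirst_succ_zero (r : ℝ) (n : ℕ) :
    rStirlingFirst r (n + 1) 0 = (r + n) * rStirlingFirst r n 0 := by
  simp only [← coeff_risingPolynomial, risingPolynomial, Finset.prod_range_succ, mul_add,
    Polynomial.coeff_add, Polynomial.coeff_mul_C, Polynomial.coeff_mul_X_zero]
  ring

theorem rStirlingFirst_succ_succ (r : ℝ) (n k : ℕ) :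
    rStirlingFirst r (n + 1) (k + 1) =
      rStirlingFirst r n k + (r + n) * rStirlingFirst r n (k + 1) := by
  simp only [← coeff_risingPolynomial, risingPolynomial, Finset.prod_range_succ, mul_add,
    Polynomial.coeff_add, Polynomial.coeff_mul_C, Polynomial.coeff_mul_X]
  ring

theorem sum_rStirlingFirst_mul_pow (r : ℝ) (n : ℕ) (y : ℝ) :
    ∑ j ∈ Finset.range (n + 1), rStirlingFirst r n j * y ^ j =
      ∏ i ∈ Finset.range n, (y + r + i) := by
  have hdeg : (risingPolynomial r n).natDegree < n + 1 := by
    refine Nat.lt_succ_of_le ((Polynomial.natDegree_prod_le _ _).trans ?_)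
    simp only [Polynomial.natDegree_X_add_C]
    simp
  have h := Polynomial.eval_eq_sum_range' hdeg y
  simp only [coeff_risingPolynomial] at h
  rw [← h, risingPolynomial, Polynomial.eval_prod]
  refine Finset.prod_congr rfl fun i _ => ?_
  simp [add_assoc]

/-- The rows of the triangle of `r`-Stirling numbers of the first kind are log-concave without
internal zeros. -/
theorem rStirlingFirst_mul_le {r : ℝ} (hr : 0 ≤ r) (n : ℕ) {i j : ℕ} (hij : i ≤ j) :
    rStirlingFirst r n i * rStirlingFirst r n (j + 1) ≤
      rStirlingFirst r n (i + 1) * rStirlingFirst r n j := by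
  induction n generalizing i j with
  | zero => simp [rStirlingFirst_eq_zero_of_lt r (Nat.succ_pos j),
      rStirlingFirst_eq_zero_of_lt r (Nat.succ_pos i)]
  | succ n ih =>
    have hs : 0 ≤ r + n := by positivity
    have h0 := rStirlingFirst_nonneg hr n
    rcases hij.eq_or_lt with rfl | hlt
    · exact (mul_comm _ _).le
    obtain ⟨j, rfl⟩ : ∃ l, j = l + 1 := ⟨j - 1, by omega⟩
    rcases i with _ | i
    · rw [rStirlingFirst_succ_zero, rStirlingFirst_succ_succ, rStirlingFirst_succ_succ,
        rStirlingFirst_succ_succ]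
      have h1 := mul_le_mul_of_nonneg_left (ih (Nat.zero_le (j + 1))) (mul_nonneg hs hs)
      have h2 := mul_nonneg (h0 0) (h0 j)
      have h3 := mul_nonneg hs (mul_nonneg (h0 1) (h0 j))
      simp only [zero_add] at h1 ⊢
      nlinarith
    · simp only [rStirlingFirst_succ_succ]
      -- Expand both sides by the recurrence and compare powers of `r + n`: `h1` is order zero, `h2`
      -- order two. The linear order skips an index and chains two instances through the middle
      -- product; this needs `i + 1 ≤ j`, hence the separate case of equal indices.
      have h1 := ih (show i ≤ j by omega)
      have h2 := mul_le_mul_of_nonneg_left (ih hij) (mul_nonneg hs hs)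
      have h3 := mul_le_mul_of_nonneg_left
        ((ih (show i ≤ j + 1 by omega)).trans (ih (show i + 1 ≤ j by omega))) hs
      nlinarith

theorem iteratedDeriv_prod_add_eq (r : ℝ) (n m : ℕ) :
    iteratedDeriv m (fun y : ℂ => ∏ i ∈ Finset.range n, (y + r + i)) 0 =
      m.factorial * rStirlingFirst r n m := by
  set p : Polynomial ℂ := (risingPolynomial r n).map Complex.ofRealHom with hp
  have h1 : (fun y : ℂ => ∏ i ∈ Finset.range n, (y + r + i)) = fun y => p.eval y := by
    ext y
    rw [hp, risingPolynomial, Polynomial.map_prod, Polynomial.eval_prod]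
    refine Finset.prod_congr rfl fun i _ => ?_
    simp [add_assoc]
  have h2 : ∀ q : Polynomial ℂ, iteratedDeriv m (fun y => q.eval y) =
      fun y => (Polynomial.derivative^[m] q).eval y := by
    induction m with
    | zero => simp
    | succ m ih =>
      intro q
      rw [iteratedDeriv_succ']
      have : deriv (fun y => q.eval y) = fun y => (Polynomial.derivative q).eval y := by
        ext y
        exact q.deriv
      rw [this, ih, Function.iterate_succ_apply]
  rw [h1, h2]
  dsimp only
  rw [← Polynomial.coeff_zero_eq_eval_zero, Polynomial.coeff_iterate_derivative, zero_add,
    Nat.descFactorial_self, hp, Polynomial.coeff_map, coeff_risingPolynomial]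
  simp

/-- Leibniz's rule for the generating polynomial factored as `normalizedRising (y + r) n` times a
constant times `e^(y log n)`: each derivative falling on the exponential yields one factor `log n`.
-/
theorem factorial_mul_rStirlingFirst_eq (r : ℝ) {n : ℕ} (hn : 2 ≤ n) (j : ℕ) :
    ((j.factorial * rStirlingFirst r n j /
      (n.factorial / n * Real.exp (r * Real.log n) * Real.log n ^ j) : ℝ) : ℂ) =
    ∑ m ∈ Finset.range (j + 1), (j.choose m : ℂ) *
      iteratedDeriv m (fun y : ℂ => normalizedRising (y + r) n) 0 / ((Real.log n : ℝ) : ℂ) ^ m := by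
  have h0 : (n : ℂ) ≠ 0 := by exact_mod_cast (by omega : n ≠ 0)
  have h1 : (n.factorial : ℂ) ≠ 0 := by exact_mod_cast n.factorial_ne_zero
  have h2 : ((Real.log n : ℝ) : ℂ) ≠ 0 := by
    exact_mod_cast (Real.log_pos (by exact_mod_cast hn)).ne'
  set ℓ : ℂ := ((Real.log n : ℝ) : ℂ) with hℓ
  have hF : (fun y : ℂ => ∏ i ∈ Finset.range n, (y + r + i)) = fun y =>
      normalizedRising (y + r) n * (n.factorial / n * Complex.exp (r * ℓ) *
        Complex.exp (ℓ * y)) := by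
    ext y
    have h3 : Complex.exp (-(y + r) * ℓ) * (Complex.exp (r * ℓ) * Complex.exp (ℓ * y)) = 1 := by
      rw [← Complex.exp_add, ← Complex.exp_add, ← Complex.exp_zero]
      congr 1
      ring
    have h4 : (n : ℂ) / n.factorial * (n.factorial / n) = 1 := by field_simp
    rw [normalizedRising, ← hℓ]
    linear_combination (-(∏ i ∈ Finset.range n, (y + r + i)) * ((n : ℂ) / n.factorial *
      (n.factorial / n))) * h3 - (∏ i ∈ Finset.range n, (y + r + i)) * h4
  have hd : Differentiable ℂ fun y : ℂ => normalizedRising (y + r) n :=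
    (differentiable_normalizedRising n).comp (differentiable_id.add_const _)
  have hL := iteratedDeriv_prod_add_eq r n j
  rw [hF, iteratedDeriv_fun_mul hd.contDiff.contDiffAt (by fun_prop)] at hL
  simp only [iteratedDeriv_const_mul_field, iteratedDeriv_cexp_const_mul, mul_zero,
    Complex.exp_zero, mul_one] at hL
  simp only [Complex.ofReal_div, Complex.ofReal_mul, Complex.ofReal_pow, Complex.ofReal_exp,
    Complex.ofReal_natCast, ← hℓ]
  rw [← hL, Finset.sum_div]
  refine Finset.sum_congr rfl fun m hm => ?_
  have hm' : m ≤ j := by simpa [Nat.lt_succ_iff] using hm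
  have h5 : ℓ ^ j = ℓ ^ (j - m) * ℓ ^ m := by rw [← pow_add, Nat.sub_add_cancel hm']
  have h6 := Complex.exp_ne_zero (r * ℓ)
  rw [h5]
  field_simp

/-- Local limit theorem for the `r`-Stirling numbers of the first kind. -/
theorem tendsto_rStirlingFirst {r : ℝ} {j : ℕ → ℕ} {c : ℝ} (hc0 : 0 < c)
    (hc : Tendsto (fun n => (j n : ℝ) / Real.log n) atTop (𝓝 c)) :
    Tendsto (fun n : ℕ => (j n).factorial * rStirlingFirst r n (j n) /
      (n.factorial / n * Real.exp (r * Real.log n) * Real.log n ^ (j n))) atTop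
      (𝓝 (Real.Gamma (c + r))⁻¹) := by
  have hd : ∀ n, Differentiable ℂ fun y : ℂ => normalizedRising (y + r) n := fun n =>
    (differentiable_normalizedRising n).comp (differentiable_id.add_const _)
  have hg : Differentiable ℂ fun y : ℂ => (Complex.Gamma (y + r))⁻¹ :=
    Complex.differentiable_one_div_Gamma.comp (differentiable_id.add_const _)
  have h := tendsto_sum_choose_mul_iteratedDeriv hd hg (fun B => ?_)
    (fun z => tendsto_normalizedRising _) hc0
    (Real.tendsto_log_atTop.comp tendsto_natCast_atTop_atTop) hc
  · have h1 : ((Complex.Gamma (c + r))⁻¹ : ℂ) = (((Real.Gamma (c + r))⁻¹ : ℝ) : ℂ) := by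
      rw [Complex.ofReal_inv, ← Complex.Gamma_ofReal, Complex.ofReal_add]
    rw [h1] at h
    have h2 := (Complex.continuous_re.tendsto _).comp h
    rw [Complex.ofReal_re] at h2
    refine h2.congr' ?_
    filter_upwards [eventually_ge_atTop 2] with n hn
    simp only [Function.comp_apply]
    rw [← factorial_mul_rStirlingFirst_eq r hn (j n), Complex.ofReal_re]
  · refine ⟨(B + |r|) * Real.exp ((B + |r| + (B + |r|) ^ 2) * 1), ?_⟩
    filter_upwards [eventually_ge_atTop 1] with n hn z hz
    have hs : ‖z + r‖ ≤ B + |r| := (norm_add_le _ _).trans (by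
      rw [Complex.norm_real, Real.norm_eq_abs]
      linarith)
    have hB : 0 ≤ B + |r| := (norm_nonneg _).trans hs
    refine (norm_normalizedRising_le hs hn).trans ?_
    have : (0 : ℝ) ≤ (n : ℝ)⁻¹ := by positivity
    gcongr
    linarith

/-! ### Second kind and Lah numbers as alternating sums -/

theorem factorial_mul_stirlingSecond_eq_sum (n k : ℕ) :
    (k.factorial : ℝ) * Nat.stirlingSecond n k =
      ∑ i ∈ Finset.range (k + 1), (-1) ^ (k + i) * (k.choose i : ℝ) * (i : ℝ) ^ n := by
  induction n generalizing k with
  | zero =>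
    rcases k with _ | k
    · simp
    · have h := add_pow (-1 : ℝ) 1 (k + 1)
      simp only [neg_add_cancel, one_pow, mul_one, ne_eq, Nat.add_eq_zero_iff, one_ne_zero,
        and_false, not_false_eq_true, zero_pow] at h
      simp only [pow_zero, mul_one, pow_add _ (k + 1), mul_assoc, ← Finset.mul_sum]
      rw [← h]
      simp
  | succ n ih =>
    rcases k with _ | k
    · simp
    · have h1 : ((k + 1).factorial : ℝ) * Nat.stirlingSecond (n + 1) (k + 1) =
          (k + 1) * ((k + 1).factorial * Nat.stirlingSecond n (k + 1)) +
            (k + 1) * (k.factorial * Nat.stirlingSecond n k) := by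
        rw [Nat.stirlingSecond_succ_succ, Nat.factorial_succ]
        push_cast
        ring
      have h2 : ∑ i ∈ Finset.range (k + 1), (-1) ^ (k + i) * (k.choose i : ℝ) * (i : ℝ) ^ n =
          ∑ i ∈ Finset.range (k + 1 + 1), (-1) ^ (k + i) * (k.choose i : ℝ) * (i : ℝ) ^ n := by
        rw [Finset.sum_range_succ _ (k + 1), Nat.choose_succ_self]
        simp
      rw [h1, ih, ih, h2, Finset.mul_sum, Finset.mul_sum, ← Finset.sum_add_distrib]
      refine Finset.sum_congr rfl fun i hi => ?_
      have hi' : i ≤ k + 1 := by simpa [Nat.lt_succ_iff] using hi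
      have h3 : (k.choose i : ℝ) * (k + 1) = ((k + 1).choose i : ℝ) * (k + 1 - i) := by
        have := congrArg (Nat.cast (R := ℝ)) (Nat.choose_mul_succ_eq k i)
        rw [Nat.cast_mul, Nat.cast_mul, Nat.cast_sub hi'] at this
        exact_mod_cast this
      have h4 : (-1 : ℝ) ^ (k + 1 + i) = -(-1) ^ (k + i) := by ring
      rw [h4]
      linear_combination (-1 : ℝ) ^ (k + i) * (i : ℝ) ^ n * h3

theorem rStirlingSecond_eq_zero_of_lt (r : ℝ) {n k : ℕ} (h : n < k) :
    rStirlingSecond r n k = 0 := by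
  simp [rStirlingSecond, Finset.Icc_eq_empty (not_le.2 h)]

theorem factorial_mul_rStirlingSecond_eq_sum (r : ℝ) (n k : ℕ) :
    (k.factorial : ℝ) * rStirlingSecond r n k =
      ∑ i ∈ Finset.range (k + 1), (-1) ^ (k + i) * (k.choose i : ℝ) * (i + r) ^ n := by
  have h1 : rStirlingSecond r n k = ∑ j ∈ Finset.range (n + 1),
      (n.choose j : ℝ) * (Nat.stirlingSecond j k : ℝ) * r ^ (n - j) := by
    refine Finset.sum_subset (fun j hj => ?_) (fun j hj hj' => ?_)
    · simp only [Finset.mem_Icc, Finset.mem_range] at hj ⊢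
      omega
    · simp only [Finset.mem_Icc, Finset.mem_range] at hj hj'
      simp [Nat.stirlingSecond_eq_zero_of_lt (show j < k by omega)]
  simp_rw [add_pow, Finset.mul_sum]
  rw [Finset.sum_comm, h1, Finset.mul_sum]
  refine Finset.sum_congr rfl fun j _ => ?_
  have h2 := factorial_mul_stirlingSecond_eq_sum j k
  calc (k.factorial : ℝ) * ((n.choose j : ℝ) * (Nat.stirlingSecond j k : ℝ) * r ^ (n - j)) =
      (n.choose j : ℝ) * r ^ (n - j) * (k.factorial * Nat.stirlingSecond j k) := by ring
    _ = _ := by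
      rw [h2, Finset.mul_sum]
      exact Finset.sum_congr rfl fun i _ => by ring

/-- Insert the alternating sum for the second kind and exchange sums: the inner sum is the
first-kind generating polynomial at `i + r`. -/
theorem factorial_mul_rLahNumber_eq_sum (r : ℝ) (n k : ℕ) :
    (k.factorial : ℝ) * rLahNumber r n k =
      ∑ i ∈ Finset.range (k + 1), (-1) ^ (k + i) * (k.choose i : ℝ) *
        ∏ l ∈ Finset.range n, (i + 2 * r + l) := by
  have h1 : rLahNumber r n k = ∑ j ∈ Finset.range (n + 1),
      rStirlingFirst r n j * rStirlingSecond r j k := by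
    refine Finset.sum_subset (fun j hj => ?_) (fun j hj hj' => ?_)
    · simp only [Finset.mem_Icc, Finset.mem_range] at hj ⊢
      omega
    · simp only [Finset.mem_Icc, Finset.mem_range] at hj hj'
      simp [rStirlingSecond_eq_zero_of_lt r (show j < k by omega)]
  have h2 : ∀ i : ℕ, ∏ l ∈ Finset.range n, (i + 2 * r + l) =
      ∑ j ∈ Finset.range (n + 1), rStirlingFirst r n j * (i + r) ^ j := by
    intro i
    rw [sum_rStirlingFirst_mul_pow]
    exact Finset.prod_congr rfl fun l _ => by ring
  simp_rw [h2, Finset.mul_sum]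
  rw [Finset.sum_comm, h1, Finset.mul_sum]
  refine Finset.sum_congr rfl fun j _ => ?_
  rw [mul_left_comm, factorial_mul_rStirlingSecond_eq_sum, Finset.mul_sum]
  exact Finset.sum_congr rfl fun i _ => by ring

theorem add_pos_of_max_pos {r : ℝ} {k : ℕ} (hr : 0 ≤ r) (hkr : 0 < max (k : ℝ) r) :
    0 < (k : ℝ) + r := by
  rcases lt_max_iff.1 hkr with h | h <;> positivity

/-- An alternating binomial sum is asymptotic to its last term if the others are negligible. -/
theorem tendsto_alternating_sum {ι : Type*} {l : Filter ι} {k : ℕ} {f : ℕ → ι → ℝ} {b : ℝ}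
    (h0 : ∀ i < k, Tendsto (f i) l (𝓝 0)) (hk : Tendsto (f k) l (𝓝 b)) :
    Tendsto (fun n => ∑ i ∈ Finset.range (k + 1), (-1) ^ (k + i) * (k.choose i : ℝ) * f i n) l
      (𝓝 b) := by
  simp_rw [Finset.sum_range_succ]
  have h1 : Tendsto (fun n => ∑ i ∈ Finset.range k, (-1) ^ (k + i) * (k.choose i : ℝ) * f i n) l
      (𝓝 (∑ i ∈ Finset.range k, (-1) ^ (k + i) * (k.choose i : ℝ) * 0)) :=
    tendsto_finsetSum _ fun i hi => (h0 i (Finset.mem_range.1 hi)).const_mul _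
  have h2 := h1.add (hk.const_mul ((-1) ^ (k + k) * (k.choose k : ℝ)))
  have h3 : (-1 : ℝ) ^ (k + k) = 1 := by rw [← two_mul]; simp
  simpa [h3] using h2

theorem tendsto_rStirlingSecond {r : ℝ} {k : ℕ} (hr : 0 ≤ r) (hkr : 0 < max (k : ℝ) r) :
    Tendsto (fun j : ℕ => k.factorial * rStirlingSecond r j k / ((k : ℝ) + r) ^ j) atTop
      (𝓝 1) := by
  have hp := add_pos_of_max_pos hr hkr
  simp_rw [factorial_mul_rStirlingSecond_eq_sum, Finset.sum_div, mul_div_assoc, ← div_pow]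
  refine tendsto_alternating_sum (f := fun i j => (((i : ℝ) + r) / (k + r)) ^ j)
    (fun i hi => ?_) ?_
  · refine tendsto_pow_atTop_nhds_zero_of_lt_one (by positivity) ?_
    rw [div_lt_one hp]
    have : (i : ℝ) < k := by exact_mod_cast hi
    linarith
  · simp [div_self hp.ne']

/-- Unlike the limit, this holds for every `j`, as the domination of whole tails requires. -/
theorem rStirlingSecond_le {r : ℝ} {k : ℕ} (hr : 0 ≤ r) (j : ℕ) :
    k.factorial * rStirlingSecond r j k ≤ 2 ^ k * ((k : ℝ) + r) ^ j := by
  have h2 : (2 : ℝ) ^ k = ∑ i ∈ Finset.range (k + 1), (k.choose i : ℝ) := by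
    exact_mod_cast (Nat.sum_range_choose k).symm
  rw [factorial_mul_rStirlingSecond_eq_sum, h2, Finset.sum_mul]
  refine Finset.sum_le_sum fun i hi => ?_
  have hi' : (i : ℝ) ≤ k := by exact_mod_cast (by simpa [Nat.lt_succ_iff] using hi : i ≤ k)
  have h1 : (-1 : ℝ) ^ (k + i) ≤ 1 := (le_abs_self _).trans (by simp)
  calc (-1 : ℝ) ^ (k + i) * (k.choose i : ℝ) * (i + r) ^ j ≤ 1 * (k.choose i : ℝ) * (i + r) ^ j :=
        by gcongr
    _ ≤ (k.choose i : ℝ) * (k + r) ^ j := by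
        rw [one_mul]
        gcongr

theorem tendsto_rising_real (s : ℝ) :
    Tendsto (fun n : ℕ => (∏ i ∈ Finset.range n, (s + i)) /
      (n.factorial / n * Real.exp (s * Real.log n))) atTop (𝓝 (Real.Gamma s)⁻¹) := by
  have h := (Complex.continuous_re.tendsto _).comp (tendsto_normalizedRising s)
  rw [Complex.Gamma_ofReal, ← Complex.ofReal_inv, Complex.ofReal_re] at h
  refine h.congr' (Eventually.of_forall fun n => ?_)
  have h1 : normalizedRising s n = (((∏ i ∈ Finset.range n, (s + i)) /
      (n.factorial / n * Real.exp (s * Real.log n)) : ℝ) : ℂ) := by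
    rw [normalizedRising, neg_mul, Complex.exp_neg]
    simp only [Complex.ofReal_div, Complex.ofReal_mul, Complex.ofReal_exp, Complex.ofReal_prod,
      Complex.ofReal_add, Complex.ofReal_natCast]
    rw [div_eq_mul_inv _ ((n.factorial : ℂ) / n * _), mul_inv, inv_div]
    ring
  simp only [Function.comp_apply, h1, Complex.ofReal_re]

theorem tendsto_rLahNumber (r : ℝ) (k : ℕ) :
    Tendsto (fun n : ℕ => k.factorial * rLahNumber r n k /
      (n.factorial / n * Real.exp ((k + 2 * r) * Real.log n))) atTop
      (𝓝 (Real.Gamma (k + 2 * r))⁻¹) := by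
  simp_rw [factorial_mul_rLahNumber_eq_sum, Finset.sum_div, mul_div_assoc]
  refine tendsto_alternating_sum (f := fun (i n : ℕ) => (∏ l ∈ Finset.range n, (i + 2 * r + l)) /
    (n.factorial / n * Real.exp ((k + 2 * r) * Real.log n))) (fun i hi => ?_)
    (tendsto_rising_real _)
  have hi' : (i : ℝ) - k < 0 := by
    have : (i : ℝ) < k := by exact_mod_cast hi
    linarith
  -- The `i`-th rising factorial is smaller than the normalisation by `n^(i - k)`.
  have h1 : Tendsto (fun n : ℕ => Real.exp ((i - k) * Real.log n)) atTop (𝓝 0) :=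
    Real.tendsto_exp_atBot.comp ((Real.tendsto_log_atTop.comp
      tendsto_natCast_atTop_atTop).const_mul_atTop_of_neg hi')
  have h2 := (tendsto_rising_real (i + 2 * r)).mul h1
  rw [mul_zero] at h2
  refine h2.congr fun n => ?_
  have h3 : Real.exp ((i - k) * Real.log n) = Real.exp ((i + 2 * r) * Real.log n) /
      Real.exp ((k + 2 * r) * Real.log n) := by
    rw [← Real.exp_sub]
    ring_nf
  have := Real.exp_ne_zero ((i + 2 * r) * Real.log n)
  rw [h3, ← div_div, ← div_div]
  field_simp

/-! ### Point masses and tails of the distribution -/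

/-- The mass which the `r`-Lah distribution gives to `j`. -/
noncomputable def rLahMass (r : ℝ) (k n j : ℕ) : ℝ :=
  rStirlingFirst r n j * rStirlingSecond r j k / rLahNumber r n k

theorem rLahMass_nonneg {r : ℝ} (hr : 0 ≤ r) (k n j : ℕ) : 0 ≤ rLahMass r k n j :=
  div_nonneg (mul_nonneg (rStirlingFirst_nonneg hr n j) (rStirlingSecond_nonneg hr j k))
    (Finset.sum_nonneg fun i _ => mul_nonneg (rStirlingFirst_nonneg hr n i)
      (rStirlingSecond_nonneg hr i k))

theorem rLahDistribution_real_eq_sum {r : ℝ} (hr : 0 ≤ r) (n k : ℕ) (S : Set ℕ) :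
    (rLahDistribution r n k).real S = ∑ j ∈ Finset.Icc k n, S.indicator (rLahMass r k n) j := by
  simp only [Measure.real, rLahDistribution, Measure.coe_finsetSum, Finset.sum_apply,
    Measure.smul_apply, smul_eq_mul]
  rw [ENNReal.toReal_sum fun j _ => ENNReal.mul_ne_top ENNReal.ofReal_ne_top
    (measure_ne_top _ _)]
  refine Finset.sum_congr rfl fun j _ => ?_
  rw [← rLahMass, ENNReal.toReal_mul, ENNReal.toReal_ofReal (rLahMass_nonneg hr k n j),
    Measure.dirac_apply' _ (MeasurableSet.of_discrete)]
  by_cases h : j ∈ S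
  · simp [h]
  · simp [h]

/-- Masses vanish outside `{k, …, n}`, so the sum can run over an index set free of `n`, as
dominated convergence requires. -/
theorem rLahDistribution_real_eq_tsum {r : ℝ} (hr : 0 ≤ r) (n k : ℕ) (S : Set ℕ) :
    (rLahDistribution r n k).real S = ∑' j, S.indicator (rLahMass r k n) j := by
  rw [rLahDistribution_real_eq_sum hr, tsum_eq_sum]
  intro j hj
  have h : rLahMass r k n j = 0 := by
    rw [Finset.mem_Icc, not_and_or, not_le, not_le] at hj
    rcases hj with hj | hj
    · simp [rLahMass, rStirlingSecond_eq_zero_of_lt r hj]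
    · simp [rLahMass, rStirlingFirst_eq_zero_of_lt r hj]
  by_cases hS : j ∈ S <;> simp [hS, h]

theorem rLahDistribution_real_singleton {r : ℝ} (hr : 0 ≤ r) (n k J : ℕ) :
    (rLahDistribution r n k).real {J} = rLahMass r k n J := by
  rw [rLahDistribution_real_eq_tsum hr, tsum_eq_single J]
  · simp
  · intro j hj
    simp [hj]

theorem rLahDistribution_real_Ici {r : ℝ} (hr : 0 ≤ r) (n k J : ℕ) :
    (rLahDistribution r n k).real (Set.Ici J) = ∑' m, rLahMass r k n (J + m) := by
  rw [rLahDistribution_real_eq_tsum hr, ← (add_right_injective J).tsum_eq]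
  · simp
  · intro j hj
    have : j ∈ Set.Ici J := by
      by_contra h
      exact hj (Set.indicator_of_notMem h _)
    exact ⟨j - J, Nat.add_sub_cancel' this⟩

/-- The sum is indexed by the distance `m` below `J`; without the guard, truncated subtraction would
repeat the mass at `0`. -/
theorem rLahDistribution_real_Iic {r : ℝ} (hr : 0 ≤ r) (n k J : ℕ) :
    (rLahDistribution r n k).real (Set.Iic J) =
      ∑' m, if m ≤ J then rLahMass r k n (J - m) else 0 := by
  rw [rLahDistribution_real_eq_tsum hr, tsum_eq_sum (s := Finset.range (J + 1)),
    tsum_eq_sum (s := Finset.range (J + 1)), ← Finset.sum_range_reflect]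
  · refine Finset.sum_congr rfl fun m hm => ?_
    have h1 : m ≤ J := by simpa [Nat.lt_succ_iff] using hm
    have h2 : J + 1 - 1 - m ∈ Set.Iic J := by
      simp only [Set.mem_Iic]
      omega
    rw [Set.indicator_of_mem h2, if_pos h1, Nat.add_sub_cancel]
  · intro m hm
    rw [if_neg (by simpa [Nat.lt_succ_iff] using hm)]
  · intro m hm
    rw [Set.indicator_of_notMem (by simpa [Nat.lt_succ_iff] using hm)]

/-! ### Comparison with Poisson weights and ratios of masses -/

theorem tendsto_log_natCast : Tendsto (fun n : ℕ => Real.log n) atTop atTop :=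
  Real.tendsto_log_atTop.comp tendsto_natCast_atTop_atTop

theorem tendsto_atTop_of_div_log {j : ℕ → ℕ} {c : ℝ} (hc0 : 0 < c)
    (hc : Tendsto (fun n => (j n : ℝ) / Real.log n) atTop (𝓝 c)) : Tendsto j atTop atTop := by
  have h1 := hc.pos_mul_atTop hc0 tendsto_log_natCast
  refine tendsto_natCast_atTop_iff (R := ℝ) |>.1 (h1.congr' ?_)
  filter_upwards [tendsto_log_natCast.eventually_gt_atTop 0] with n hn
  field_simp

theorem tendsto_add_div_log {j : ℕ → ℕ} {c : ℝ}
    (hc : Tendsto (fun n => (j n : ℝ) / Real.log n) atTop (𝓝 c)) (m : ℕ) :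
    Tendsto (fun n => ((j n + m : ℕ) : ℝ) / Real.log n) atTop (𝓝 c) := by
  have := hc.add (tendsto_const_nhds (x := (m : ℝ)) |>.div_atTop tendsto_log_natCast)
  simpa [add_div] using this

theorem tendsto_sub_div_log {j : ℕ → ℕ} {c : ℝ} (hc0 : 0 < c)
    (hc : Tendsto (fun n => (j n : ℝ) / Real.log n) atTop (𝓝 c)) (m : ℕ) :
    Tendsto (fun n => ((j n - m : ℕ) : ℝ) / Real.log n) atTop (𝓝 c) := by
  have := hc.sub (tendsto_const_nhds (x := (m : ℝ)) |>.div_atTop tendsto_log_natCast)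
  rw [sub_zero] at this
  refine this.congr' ?_
  filter_upwards [(tendsto_atTop_of_div_log hc0 hc).eventually_ge_atTop m] with n hn
  rw [Nat.cast_sub hn, sub_div]

/-- Precise comparison of the `r`-Lah masses with the Poisson distribution of parameter
`(k + r) log n`. -/
theorem tendsto_rLahMass_div_poisson {r : ℝ} {k : ℕ} (hr : 0 ≤ r) (hkr : 0 < max (k : ℝ) r)
    {j : ℕ → ℕ} {c : ℝ} (hc0 : 0 < c)
    (hc : Tendsto (fun n => (j n : ℝ) / Real.log n) atTop (𝓝 c)) :
    Tendsto (fun n : ℕ => rLahMass r k n (j n) / (Real.exp (-((k + r) * Real.log n)) *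
      ((k + r) * Real.log n) ^ j n / (j n).factorial)) atTop
      (𝓝 (Real.Gamma (k + 2 * r) / Real.Gamma (c + r))) := by
  have hp := add_pos_of_max_pos hr hkr
  have hG : (Real.Gamma (k + 2 * r))⁻¹ ≠ 0 := inv_ne_zero (Real.Gamma_pos_of_pos (by linarith)).ne'
  have h := ((tendsto_rStirlingFirst (r := r) hc0 hc).mul
    ((tendsto_rStirlingSecond hr hkr).comp (tendsto_atTop_of_div_log hc0 hc))).div
    (tendsto_rLahNumber r k) hG
  rw [mul_one, div_inv_eq_mul, mul_comm (Real.Gamma (c + r))⁻¹, ← div_eq_mul_inv] at h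
  refine h.congr' ?_
  filter_upwards [eventually_ge_atTop 2, eventually_ge_atTop k] with n hn hkn
  have hℓ : 0 < Real.log n := Real.log_pos (by exact_mod_cast hn)
  have hn0 : (0 : ℝ) < n := by positivity
  have hL := rLahNumber_pos hr hkr hkn
  simp only [Pi.div_apply, Function.comp_apply, rLahMass]
  set ℓ := Real.log n
  -- The Lah normalisation exceeds the first-kind one by `n^(k + r)`, which is exactly the Poisson
  -- constant.
  have h1 : Real.exp ((k + 2 * r) * ℓ) = Real.exp (r * ℓ) * Real.exp ((k + r) * ℓ) := by
    rw [← Real.exp_add]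
    ring_nf
  rw [h1, Real.exp_neg, mul_pow]
  have h2 := Real.exp_ne_zero (r * ℓ)
  have h3 := Real.exp_ne_zero ((k + r) * ℓ)
  have h4 : (n.factorial : ℝ) ≠ 0 := by exact_mod_cast n.factorial_ne_zero
  have h5 : (k.factorial : ℝ) ≠ 0 := by exact_mod_cast k.factorial_ne_zero
  have h6 : ((j n).factorial : ℝ) ≠ 0 := by exact_mod_cast (j n).factorial_ne_zero
  field_simp

/-- The local limit theorem has the same limit along `j` and `j + m`, so the ratio is governed by
the normalisations: `(log n)^m` over `(j + m).descFactorial m`. -/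
theorem tendsto_rStirlingFirst_ratio {r : ℝ} (hr : 0 ≤ r) {j : ℕ → ℕ} {c : ℝ} (hc0 : 0 < c)
    (hc : Tendsto (fun n => (j n : ℝ) / Real.log n) atTop (𝓝 c)) (m : ℕ) :
    Tendsto (fun n : ℕ => rStirlingFirst r n (j n + m) / rStirlingFirst r n (j n)) atTop
      (𝓝 (c⁻¹ ^ m)) := by
  have hG : (Real.Gamma (c + r))⁻¹ ≠ 0 := inv_ne_zero (Real.Gamma_pos_of_pos (by positivity)).ne'
  have hm := tendsto_add_div_log hc m
  have h1 := (tendsto_rStirlingFirst (r := r) hc0 hm).div (tendsto_rStirlingFirst hc0 hc) hG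
  have h2 := h1.div (tendsto_descFactorial_div_pow (tendsto_atTop_of_div_log hc0 hm)
    tendsto_log_natCast hm m) (pow_pos hc0 m).ne'
  rw [div_self hG, ← inv_eq_one_div, ← inv_pow] at h2
  refine h2.congr' ?_
  filter_upwards [eventually_ge_atTop 2] with n hn
  have hℓ : 0 < Real.log n := Real.log_pos (by exact_mod_cast hn)
  have hn0 : (0 : ℝ) < n := by positivity
  simp only [Pi.div_apply]
  have h3 : ((j n + m).factorial : ℝ) = (j n).factorial * (j n + m).descFactorial m := by
    have := Nat.factorial_mul_descFactorial (Nat.le_add_left m (j n))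
    rw [Nat.add_sub_cancel] at this
    exact_mod_cast this.symm
  have h4 : (n.factorial : ℝ) ≠ 0 := by exact_mod_cast n.factorial_ne_zero
  have h6 : ((j n).factorial : ℝ) ≠ 0 := by exact_mod_cast (j n).factorial_ne_zero
  have h7 : ((j n + m).descFactorial m : ℝ) ≠ 0 := by
    exact_mod_cast (Nat.descFactorial_pos.2 (Nat.le_add_left m (j n))).ne'
  rw [h3, pow_add]
  by_cases h8 : rStirlingFirst r n (j n) = 0
  · simp [h8]
  · field_simp

theorem tendsto_rStirlingSecond_ratio {r : ℝ} {k : ℕ} (hr : 0 ≤ r) (hkr : 0 < max (k : ℝ) r)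
    {j : ℕ → ℕ} (hj : Tendsto j atTop atTop) (m : ℕ) :
    Tendsto (fun n : ℕ => rStirlingSecond r (j n + m) k / rStirlingSecond r (j n) k) atTop
      (𝓝 (((k : ℝ) + r) ^ m)) := by
  have hp := add_pos_of_max_pos hr hkr
  have h := tendsto_rStirlingSecond hr hkr
  have h1 := ((h.comp ((tendsto_add_atTop_nat m).comp hj)).div (h.comp hj)
    one_ne_zero).const_mul (((k : ℝ) + r) ^ m)
  rw [div_one, mul_one] at h1
  refine h1.congr fun n => ?_
  simp only [Pi.div_apply, Function.comp_apply]
  have h5 : (k.factorial : ℝ) ≠ 0 := by exact_mod_cast k.factorial_ne_zero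
  by_cases h8 : rStirlingSecond r (j n) k = 0
  · simp [h8]
  · rw [show ((k : ℝ) + r) ^ (j n + m) = (k + r) ^ j n * (k + r) ^ m from pow_add _ _ _]
    field_simp

theorem tendsto_rLahMass_ratio {r : ℝ} {k : ℕ} (hr : 0 ≤ r) (hkr : 0 < max (k : ℝ) r)
    {j : ℕ → ℕ} {c : ℝ} (hc0 : 0 < c)
    (hc : Tendsto (fun n => (j n : ℝ) / Real.log n) atTop (𝓝 c)) (m : ℕ) :
    Tendsto (fun n : ℕ => rLahMass r k n (j n + m) / rLahMass r k n (j n)) atTop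
      (𝓝 ((((k : ℝ) + r) / c) ^ m)) := by
  have h := (tendsto_rStirlingFirst_ratio hr hc0 hc m).mul
    (tendsto_rStirlingSecond_ratio hr hkr (tendsto_atTop_of_div_log hc0 hc) m)
  rw [← mul_pow, inv_mul_eq_div] at h
  refine h.congr' ?_
  filter_upwards [eventually_ge_atTop k] with n hkn
  have hL := (rLahNumber_pos hr hkr hkn).ne'
  rw [rLahMass, rLahMass, div_div_div_cancel_right₀ hL, div_mul_div_comm]

theorem eventually_rStirlingFirst_pos {r : ℝ} (hr : 0 ≤ r) {j : ℕ → ℕ} {c : ℝ} (hc0 : 0 < c)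
    (hc : Tendsto (fun n => (j n : ℝ) / Real.log n) atTop (𝓝 c)) :
    ∀ᶠ n in atTop, 0 < rStirlingFirst r n (j n) := by
  have hG : 0 < (Real.Gamma (c + r))⁻¹ := inv_pos.2 (Real.Gamma_pos_of_pos (by positivity))
  filter_upwards [(tendsto_rStirlingFirst (r := r) hc0 hc).eventually_const_lt hG] with n hn
  refine (rStirlingFirst_nonneg hr n (j n)).lt_of_ne fun h => ?_
  simp [← h] at hn

theorem eventually_rStirlingSecond_ge {r : ℝ} {k : ℕ} (hr : 0 ≤ r) (hkr : 0 < max (k : ℝ) r)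
    {j : ℕ → ℕ} (hj : Tendsto j atTop atTop) :
    ∀ᶠ n in atTop, ((k : ℝ) + r) ^ j n ≤ 2 * (k.factorial * rStirlingSecond r (j n) k) := by
  have hp := add_pos_of_max_pos hr hkr
  filter_upwards [((tendsto_rStirlingSecond hr hkr).comp hj).eventually_const_lt
    (show (1 / 2 : ℝ) < 1 by norm_num)] with n hn
  rw [Function.comp_apply, lt_div_iff₀ (by positivity)] at hn
  linarith

/-! ### Geometric domination and tail sums -/

/-- Geometric bound for log-concave sequences, to the right. -/
theorem rStirlingFirst_add_le {r : ℝ} (hr : 0 ≤ r) {n J : ℕ} {q : ℝ} (hq : 0 ≤ q)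
    (hJ : 0 < rStirlingFirst r n J)
    (h : rStirlingFirst r n (J + 1) ≤ q * rStirlingFirst r n J) (m : ℕ) :
    rStirlingFirst r n (J + m) ≤ q ^ m * rStirlingFirst r n J := by
  induction m with
  | zero => simp
  | succ m ih =>
    have h1 := rStirlingFirst_mul_le hr n (Nat.le_add_right J m)
    have h2 := mul_le_mul_of_nonneg_right h (rStirlingFirst_nonneg hr n (J + m))
    have h3 : rStirlingFirst r n J * rStirlingFirst r n (J + m + 1) ≤
        rStirlingFirst r n J * (q * rStirlingFirst r n (J + m)) := by linarith
    -- Only the term at `J` is cancelled, so later terms may vanish.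
    have h4 := le_of_mul_le_mul_left h3 hJ
    rw [← add_assoc, pow_succ', mul_assoc]
    exact h4.trans (mul_le_mul_of_nonneg_left ih hq)

/-- Geometric bound for log-concave sequences, to the left. -/
theorem rStirlingFirst_sub_le {r : ℝ} (hr : 0 ≤ r) {n J : ℕ} {q : ℝ} (hq : 0 ≤ q)
    (hJ : 0 < rStirlingFirst r n J)
    (h : rStirlingFirst r n (J - 1) ≤ q * rStirlingFirst r n J) {m : ℕ} (hm : m ≤ J) :
    rStirlingFirst r n (J - m) ≤ q ^ m * rStirlingFirst r n J := by
  induction m with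
  | zero => simp
  | succ m ih =>
    have ih := ih (by omega)
    have h1 := rStirlingFirst_mul_le hr n (show J - (m + 1) ≤ J - 1 by omega)
    rw [show J - 1 + 1 = J by omega, show J - (m + 1) + 1 = J - m by omega] at h1
    have h2 := mul_le_mul_of_nonneg_left h (rStirlingFirst_nonneg hr n (J - m))
    have h3 : rStirlingFirst r n (J - (m + 1)) * rStirlingFirst r n J ≤
        (q * rStirlingFirst r n (J - m)) * rStirlingFirst r n J := by linarith
    have h4 := le_of_mul_le_mul_right h3 hJ
    rw [pow_succ', mul_assoc]
    exact h4.trans (mul_le_mul_of_nonneg_left ih hq)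

/-- Second-kind numbers may be replaced by powers of `k + r` at bounded cost: `2 ^ k` from the upper
bound at `i`, and `2` from the lower bound at `j`. -/
theorem rLahMass_div_le {r : ℝ} {k n i j : ℕ} (hr : 0 ≤ r) (hkr : 0 < max (k : ℝ) r)
    (hkn : k ≤ n) (hj : 0 < rStirlingFirst r n j)
    (hj2 : ((k : ℝ) + r) ^ j ≤ 2 * (k.factorial * rStirlingSecond r j k)) {A : ℝ}
    (hi : rStirlingFirst r n i ≤ A * rStirlingFirst r n j) :
    rLahMass r k n i / rLahMass r k n j ≤ 2 ^ (k + 1) * (A * (((k : ℝ) + r) ^ i / (k + r) ^ j)) := by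
  have hp := add_pos_of_max_pos hr hkr
  have hL := rLahNumber_pos hr hkr hkn
  have hA : 0 ≤ A := by
    by_contra h
    have := mul_neg_of_neg_of_pos (not_le.1 h) hj
    linarith [rStirlingFirst_nonneg hr n i]
  have h5 : (0 : ℝ) < k.factorial := by exact_mod_cast k.factorial_pos
  have hS : 0 < rStirlingSecond r j k := by
    refine (rStirlingSecond_nonneg hr j k).lt_of_ne fun h => ?_
    rw [← h] at hj2
    have : 0 < ((k : ℝ) + r) ^ j := by positivity
    linarith
  rw [rLahMass, rLahMass, div_div_div_cancel_right₀ hL.ne', ← div_mul_div_comm, mul_left_comm]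
  refine mul_le_mul ((div_le_iff₀ hj).2 hi) ?_ (div_nonneg (rStirlingSecond_nonneg hr i k) hS.le) hA
  rw [div_le_iff₀ hS, ← mul_div_assoc, div_mul_eq_mul_div, le_div_iff₀ (by positivity)]
  have h6 := rStirlingSecond_le (k := k) hr i
  refine le_of_mul_le_mul_left ?_ h5
  calc (k.factorial : ℝ) * (rStirlingSecond r i k * ((k : ℝ) + r) ^ j) =
      (k.factorial * rStirlingSecond r i k) * ((k : ℝ) + r) ^ j := by ring
    _ ≤ (2 ^ k * ((k : ℝ) + r) ^ i) * (2 * (k.factorial * rStirlingSecond r j k)) := by gcongr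
    _ = _ := by ring

theorem tendsto_upper_tail {r : ℝ} {k : ℕ} (hr : 0 ≤ r) (hkr : 0 < max (k : ℝ) r) {x : ℝ}
    (hx : 1 < x) {j : ℕ → ℕ}
    (hc : Tendsto (fun n => (j n : ℝ) / Real.log n) atTop (𝓝 ((k + r) * x))) :
    Tendsto (fun n : ℕ => (rLahDistribution r n k).real (Set.Ici (j n)) / rLahMass r k n (j n))
      atTop (𝓝 (x / (x - 1))) := by
  have hp := add_pos_of_max_pos hr hkr
  have hx0 : 0 < x := by linarith
  have hc0 : 0 < ((k : ℝ) + r) * x := by positivity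
  have hx1 : x⁻¹ < 1 := inv_lt_one_of_one_lt₀ hx
  -- The limiting ratio is `x⁻¹`; any `q` strictly between it and `1` leaves room for the ratio at
  -- finite `n`.
  obtain ⟨q, hq1, hq2⟩ := exists_between hx1
  have hq0 : 0 < q := lt_trans (by positivity) hq1
  have hlim : x / (x - 1) = ∑' m : ℕ, x⁻¹ ^ m := by
    rw [tsum_geometric_of_lt_one (by positivity) hx1]
    have : x - 1 ≠ 0 := by linarith
    field_simp
  simp_rw [rLahDistribution_real_Ici hr, ← tsum_div_const]
  rw [hlim]
  have hratio := tendsto_rStirlingFirst_ratio hr hc0 hc 1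
  have hlt : (((k : ℝ) + r) * x)⁻¹ ^ 1 < q / (k + r) := by
    rw [pow_one, mul_inv, lt_div_iff₀ hp, mul_right_comm, inv_mul_cancel₀ hp.ne', one_mul]
    exact hq1
  refine tendsto_tsum_of_dominated_convergence (bound := fun m => 2 ^ (k + 1) * q ^ m)
    ((summable_geometric_of_lt_one hq0.le hq2).mul_left _) (fun m => ?_) ?_
  · have h := tendsto_rLahMass_ratio hr hkr hc0 hc m
    rwa [div_mul_cancel_left₀ hp.ne'] at h
  · filter_upwards [hratio.eventually_lt_const hlt, eventually_rStirlingFirst_pos hr hc0 hc,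
      eventually_rStirlingSecond_ge hr hkr (tendsto_atTop_of_div_log hc0 hc),
      eventually_ge_atTop k] with n h1 h2 h3 hkn m
    rw [div_lt_iff₀ h2] at h1
    rw [Real.norm_of_nonneg (div_nonneg (rLahMass_nonneg hr _ _ _) (rLahMass_nonneg hr _ _ _))]
    refine (rLahMass_div_le hr hkr hkn h2 h3
      (rStirlingFirst_add_le hr (by positivity) h2 h1.le m)).trans (le_of_eq ?_)
    rw [show ((k : ℝ) + r) ^ (j n + m) = (k + r) ^ j n * (k + r) ^ m from pow_add _ _ _, div_pow]
    field_simp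

theorem tendsto_lower_tail {r : ℝ} {k : ℕ} (hr : 0 ≤ r) (hkr : 0 < max (k : ℝ) r) {x : ℝ}
    (hx0 : 0 < x) (hx : x < 1) {j : ℕ → ℕ}
    (hc : Tendsto (fun n => (j n : ℝ) / Real.log n) atTop (𝓝 ((k + r) * x))) :
    Tendsto (fun n : ℕ => (rLahDistribution r n k).real (Set.Iic (j n)) / rLahMass r k n (j n))
      atTop (𝓝 (1 / (1 - x))) := by
  have hp := add_pos_of_max_pos hr hkr
  have hc0 : 0 < ((k : ℝ) + r) * x := by positivity
  have hj := tendsto_atTop_of_div_log hc0 hc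
  obtain ⟨q, hq1, hq2⟩ := exists_between hx
  have hq0 : 0 < q := hx0.trans hq1
  simp_rw [rLahDistribution_real_Iic hr, ← tsum_div_const]
  rw [one_div, ← tsum_geometric_of_lt_one hx0.le hx]
  -- Downward ratios are inverses of upward ones started from `j n - 1`, which has the same
  -- logarithmic rate.
  have hratio : Tendsto (fun n => rStirlingFirst r n (j n - 1) / rStirlingFirst r n (j n)) atTop
      (𝓝 (((k : ℝ) + r) * x)) := by
    have h := (tendsto_rStirlingFirst_ratio hr hc0 (tendsto_sub_div_log hc0 hc 1) 1).inv₀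
      (by positivity)
    rw [pow_one, inv_inv] at h
    refine h.congr' ?_
    filter_upwards [hj.eventually_ge_atTop 1] with n hn
    rw [inv_div, Nat.sub_add_cancel hn]
  have hlt : ((k : ℝ) + r) * x < q * (k + r) := by
    rw [mul_comm]
    gcongr
  refine tendsto_tsum_of_dominated_convergence (bound := fun m => 2 ^ (k + 1) * q ^ m)
    ((summable_geometric_of_lt_one hq0.le hq2).mul_left _) (fun m => ?_) ?_
  · have h := (tendsto_rLahMass_ratio hr hkr hc0 (tendsto_sub_div_log hc0 hc m) m).inv₀
      (by positivity)
    rw [div_mul_cancel_left₀ hp.ne', inv_pow, inv_inv] at h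
    refine h.congr' ?_
    filter_upwards [hj.eventually_ge_atTop m] with n hn
    rw [inv_div, Nat.sub_add_cancel hn, if_pos hn]
  · filter_upwards [hratio.eventually_lt_const hlt, eventually_rStirlingFirst_pos hr hc0 hc,
      eventually_rStirlingSecond_ge hr hkr hj, eventually_ge_atTop k] with n h1 h2 h3 hkn m
    rw [div_lt_iff₀ h2] at h1
    split_ifs with hm
    · rw [Real.norm_of_nonneg (div_nonneg (rLahMass_nonneg hr _ _ _) (rLahMass_nonneg hr _ _ _))]
      refine (rLahMass_div_le hr hkr hkn h2 h3
        (rStirlingFirst_sub_le hr (by positivity) h2 h1.le hm)).trans (le_of_eq ?_)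
      rw [show ((k : ℝ) + r) ^ j n = (k + r) ^ (j n - m) * (k + r) ^ m by
        rw [← pow_add, Nat.sub_add_cancel hm], mul_pow]
      field_simp
    · simp only [zero_div, norm_zero]
      positivity

/-! ### Stirling's formula for the Poisson weight -/

theorem tendsto_poisson_div {κ x : ℝ} (hκ : 0 < κ) (hx : 0 < x) {u : ℕ → ℝ}
    (hu : Tendsto u atTop (𝓝 x)) {j : ℕ → ℕ}
    (hj : ∀ᶠ n in atTop, (j n : ℝ) = κ * u n * Real.log n) :
    Tendsto (fun n : ℕ => (Real.exp (-(κ * Real.log n)) * (κ * Real.log n) ^ j n /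
        (j n).factorial) /
      ((n : ℝ) ^ (-κ * (u n * Real.log (u n) - u n + 1)) /
        Real.sqrt (2 * Real.pi * κ * x * Real.log n))) atTop (𝓝 1) := by
  have hc : Tendsto (fun n => (j n : ℝ) / Real.log n) atTop (𝓝 (κ * x)) := by
    refine (hu.const_mul κ).congr' ?_
    filter_upwards [hj, tendsto_log_natCast.eventually_gt_atTop 0] with n h1 h2
    rw [h1]
    field_simp
  have hja := tendsto_atTop_of_div_log (by positivity) hc
  have hst : Tendsto (fun m : ℕ => (m.factorial : ℝ) /
      (Real.sqrt (2 * m * Real.pi) * (m / Real.exp 1) ^ m)) atTop (𝓝 1) := by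
    refine (Asymptotics.isEquivalent_iff_tendsto_one ?_).1 Stirling.factorial_isEquivalent_stirling
    filter_upwards [eventually_gt_atTop 0] with m hm
    positivity
  have h1 := (hst.comp hja).inv₀ one_ne_zero
  have h2 : Tendsto (fun n => Real.sqrt (x / u n)) atTop (𝓝 1) := by
    have := (tendsto_const_nhds (x := x)).div hu hx.ne'
    rw [div_self hx.ne'] at this
    have h := (Real.continuous_sqrt.tendsto 1).comp this
    rwa [Real.sqrt_one] at h
  have h3 := h1.mul h2
  rw [inv_one, mul_one] at h3
  refine h3.congr' ?_
  filter_upwards [hj, hu.eventually_const_lt hx, eventually_ge_atTop 2] with n h4 h5 hn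
  have hℓ : 0 < Real.log n := Real.log_pos (by exact_mod_cast hn)
  have hn0 : (0 : ℝ) < n := by positivity
  simp only [Function.comp_apply]
  -- The square root contains the limit `x` in place of `u n`, a harmless factor tending to `1`.
  have hsq : Real.sqrt (2 * Real.pi * κ * x * Real.log n) =
      Real.sqrt (2 * j n * Real.pi) * Real.sqrt (x / u n) := by
    rw [← Real.sqrt_mul (by positivity), h4]
    congr 1
    field_simp
  -- In the exponent `u n` cannot be replaced by `x`, since the error is multiplied by `log n`; here
  -- the identity is exact.
  have hpow : (n : ℝ) ^ (-κ * (u n * Real.log (u n) - u n + 1)) =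
      Real.exp (-(κ * Real.log n)) * (κ * Real.log n) ^ j n / (j n / Real.exp 1) ^ j n := by
    have h6 : (κ * Real.log n) / (j n / Real.exp 1) = Real.exp (1 - Real.log (u n)) := by
      rw [Real.exp_sub, Real.exp_log h5, h4]
      field_simp
    rw [mul_div_assoc, ← div_pow, h6, ← Real.exp_nat_mul, ← Real.exp_add,
      Real.rpow_def_of_pos hn0, h4]
    congr 1
    ring
  have hj0 : (0 : ℝ) < j n := by
    rw [h4]
    positivity
  have h7 : Real.sqrt (2 * j n * Real.pi) ≠ 0 := by positivity
  have h8 : Real.sqrt (x / u n) ≠ 0 := by positivity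
  have h9 : ((j n).factorial : ℝ) ≠ 0 := by exact_mod_cast (j n).factorial_ne_zero
  rw [hsq, hpow]
  field_simp

/-! ### Assembly of the three asymptotics -/

theorem mainTheorem6 (k : ℕ) (r : ℝ) (hr : 0 ≤ r) (hkr : 0 < max (k : ℝ) r)
    (x : ℝ) (hx : 0 < x) (u : ℕ → ℝ) (hu : Tendsto u atTop (𝓝 x))
    (hint : ∀ n : ℕ, 1 ≤ n → ∃ m : ℤ, ((k : ℝ) + r) * u n * Real.log n = m) :
    (Asymptotics.IsEquivalent atTop
      (fun n : ℕ => (rLahDistribution r n k).real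
        {j : ℕ | (j : ℝ) = ((k : ℝ) + r) * u n * Real.log n})
      (fun n : ℕ =>
        (n : ℝ) ^ (-((k : ℝ) + r) * (u n * Real.log (u n) - u n + 1)) /
            Real.sqrt (2 * Real.pi * ((k : ℝ) + r) * x * Real.log n) *
          (Real.Gamma ((k : ℝ) + 2 * r) / Real.Gamma (((k : ℝ) + r) * x + r)))) ∧
    (1 < x → Asymptotics.IsEquivalent atTop
      (fun n : ℕ => (rLahDistribution r n k).real
        {j : ℕ | (j : ℝ) ≥ ((k : ℝ) + r) * u n * Real.log n})
      (fun n : ℕ =>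
        x / (x - 1) *
          ((n : ℝ) ^ (-((k : ℝ) + r) * (u n * Real.log (u n) - u n + 1)) /
            Real.sqrt (2 * Real.pi * ((k : ℝ) + r) * x * Real.log n)) *
          (Real.Gamma ((k : ℝ) + 2 * r) / Real.Gamma (((k : ℝ) + r) * x + r)))) ∧
    (x < 1 → Asymptotics.IsEquivalent atTop
      (fun n : ℕ => (rLahDistribution r n k).real
        {j : ℕ | (j : ℝ) ≤ ((k : ℝ) + r) * u n * Real.log n})
      (fun n : ℕ =>
        1 / (1 - x) *
          ((n : ℝ) ^ (-((k : ℝ) + r) * (u n * Real.log (u n) - u n + 1)) /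
            Real.sqrt (2 * Real.pi * ((k : ℝ) + r) * x * Real.log n)) *
          (Real.Gamma ((k : ℝ) + 2 * r) / Real.Gamma (((k : ℝ) + r) * x + r)))) := by
  have hp := add_pos_of_max_pos hr hkr
  have hc0 : 0 < ((k : ℝ) + r) * x := by positivity
  -- The floor is only a way to name the integer: it is exact once `u n > 0` and `n ≥ 2`, by
  -- integrality.
  set j : ℕ → ℕ := fun n => ⌊((k : ℝ) + r) * u n * Real.log n⌋₊ with hjdef
  have hj : ∀ᶠ n in atTop, (j n : ℝ) = (k + r) * u n * Real.log n := by
    filter_upwards [hu.eventually_const_lt hx, eventually_ge_atTop 2] with n h1 hn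
    have hℓ : 0 < Real.log n := Real.log_pos (by exact_mod_cast hn)
    obtain ⟨m, hm⟩ := hint n (by omega)
    have hm0 : (0 : ℝ) ≤ m := by
      rw [← hm]
      positivity
    lift m to ℕ using (by exact_mod_cast hm0)
    simp [hjdef, hm]
  have hc : Tendsto (fun n => (j n : ℝ) / Real.log n) atTop (𝓝 ((k + r) * x)) := by
    refine (hu.const_mul _).congr' ?_
    filter_upwards [hj, tendsto_log_natCast.eventually_gt_atTop 0] with n h1 h2
    rw [h1]
    field_simp
  have hΓ : Real.Gamma (k + 2 * r) / Real.Gamma ((k + r) * x + r) ≠ 0 :=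
    (div_pos (Real.Gamma_pos_of_pos (by linarith)) (Real.Gamma_pos_of_pos (by positivity))).ne'
  have hmass := (tendsto_rLahMass_div_poisson hr hkr hc0 hc).mul (tendsto_poisson_div hp hx hu hj)
  rw [mul_one] at hmass
  set Q : ℕ → ℝ := fun n => (n : ℝ) ^ (-((k : ℝ) + r) * (u n * Real.log (u n) - u n + 1)) /
    Real.sqrt (2 * Real.pi * ((k : ℝ) + r) * x * Real.log n) with hQ
  set γ : ℝ := Real.Gamma (k + 2 * r) / Real.Gamma ((k + r) * x + r) with hγ
  have hQ0 : ∀ᶠ n in atTop, 0 < Q n := by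
    filter_upwards [eventually_ge_atTop 2] with n hn
    have hℓ : 0 < Real.log n := Real.log_pos (by exact_mod_cast hn)
    have hn0 : (0 : ℝ) < n := by positivity
    positivity
  have hpoint : Asymptotics.IsEquivalent atTop (fun n => rLahMass r k n (j n))
      (fun n => Q n * γ) := by
    refine (Asymptotics.isEquivalent_iff_tendsto_one ?_).2 ?_
    · filter_upwards [hQ0] with n hn
      exact mul_ne_zero hn.ne' hΓ
    · have h1 := hmass.div_const γ
      rw [div_self hΓ] at h1
      refine h1.congr' ?_
      filter_upwards [hQ0, eventually_ge_atTop 2] with n hn h2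
      have hℓ : 0 < Real.log n := Real.log_pos (by exact_mod_cast h2)
      have hP : Real.exp (-((k + r) * Real.log n)) * ((k + r) * Real.log n) ^ j n /
          (j n).factorial ≠ 0 := by positivity
      rw [Pi.div_apply, div_mul_div_cancel₀ hP, div_div]
  have hmass0 : ∀ᶠ n in atTop, rLahMass r k n (j n) ≠ 0 := by
    filter_upwards [eventually_rStirlingFirst_pos hr hc0 hc,
      eventually_rStirlingSecond_ge hr hkr (tendsto_atTop_of_div_log hc0 hc),
      eventually_ge_atTop k] with n h1 h2 h3
    have h4 : rStirlingSecond r (j n) k ≠ 0 := fun h => by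
      rw [h, mul_zero, mul_zero] at h2
      exact absurd h2 (not_le.2 (by positivity))
    exact div_ne_zero (mul_ne_zero h1.ne' h4) (rLahNumber_pos hr hkr h3).ne'
  -- A tail is its ratio to the boundary mass times that mass, which is eventually nonzero.
  have htail : ∀ {a : ℝ} {T : ℕ → ℝ}, a ≠ 0 →
      Tendsto (fun n => T n / rLahMass r k n (j n)) atTop (𝓝 a) →
      Asymptotics.IsEquivalent atTop T (fun n => a * Q n * γ) := by
    intro a T ha hT
    have h1 : Asymptotics.IsEquivalent atTop (fun n => T n / rLahMass r k n (j n))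
        (fun _ => a) := (Asymptotics.isEquivalent_const_iff_tendsto ha).2 hT
    refine ((h1.mul hpoint).congr_left ?_).congr_right ?_
    · filter_upwards [hmass0] with n hn
      exact div_mul_cancel₀ _ hn
    · exact Eventually.of_forall fun n => (mul_assoc _ _ _).symm
  refine ⟨hpoint.congr_left ?_, fun hx1 => (htail ?_ (tendsto_upper_tail hr hkr hx1 hc)).congr_left
    ?_, fun hx1 => (htail ?_ (tendsto_lower_tail hr hkr hx hx1 hc)).congr_left ?_⟩
  · filter_upwards [hj] with n hn
    have : {i : ℕ | (i : ℝ) = (k + r) * u n * Real.log n} = {j n} := by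
      ext i
      simp [← hn]
    rw [this, rLahDistribution_real_singleton hr]
  · exact (div_pos hx (by linarith)).ne'
  · filter_upwards [hj] with n hn
    have : {i : ℕ | (i : ℝ) ≥ (k + r) * u n * Real.log n} = Set.Ici (j n) := by
      ext i
      simp [← hn]
    rw [this]
  · exact (div_pos one_pos (by linarith)).ne'
  · filter_upwards [hj] with n hn
    have : {i : ℕ | (i : ℝ) ≤ (k + r) * u n * Real.log n} = Set.Iic (j n) := by
      ext i
      simp [← hn]
    rw [this]
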